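/- Define the Euler polynomials $E_n(x)$ by the generating function $\frac{2e^{xt}}{e^t+1}=\sum_{n=0}^\infty E_n(x)\frac{t^n}{n!}$ for $|t|<\pi$, and the Euler numbers by $E_n=2^nE_n\left(\tfrac12\right)$, so that $E_0=1$, $E_2=-1$, $E_4=5$, $E_6=-61,\dots$ For every integer $k\ge 0$ and all real numbers $x,y$ with $x,y\ne 0$, the two series below converge absolutely and $$x^{2k}\sum_{n=1}^\infty\frac{\pi(-1)^{n-1}}{(2n-1)^{2k+1}\cosh\left(\frac{2n-1}{2x}\pi y\right)}+(-1)^k y^{2k}\sum_{n=1}^\infty\frac{\pi(-1)^{n-1}}{(2n-1)^{2k+1}\cosh\left(\frac{2n-1}{2y}\pi x\right)}=\sum_{\substack{k_1+k_2=k\\ k_1,k_2\ge 0}}\frac{|E_{2k_1}|\,E_{2k_2}}{(2k_1)!\,(2k_2)!}\,x^{2k_1}y^{2k_2}\left(\frac{\pi}{2}\right)^{2k+2}.$$ -/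

import Mathlib

/-- The value at `x` of the Euler polynomial `E_n`, given by the exponential generating function
`2 e^{xt} / (e^t + 1) = ∑ E_n(x) t^n / n!`, read as an identity of power series in `t`.
The denominator has constant coefficient `2 ≠ 0`, so its inverse is the genuine one. -/
noncomputable def eulerPolynomial (n : ℕ) (x : ℝ) : ℝ :=
  (n.factorial : ℝ) * PowerSeries.coeff n
    (PowerSeries.C (2 : ℝ) * PowerSeries.rescale x (PowerSeries.exp ℝ) *
      (PowerSeries.exp ℝ + 1)⁻¹)

/-- The Euler number `E_n = 2^n E_n(1/2)`; thus `E_0 = 1`, `E_2 = -1`, `E_4 = 5`, `E_6 = -61`. -/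
noncomputable def eulerNumber (n : ℕ) : ℝ :=
  2 ^ n * eulerPolynomial n (1 / 2)

/-- The summand `π (-1)^(n-1) / ((2n-1)^(2k+1) cosh ((2n-1) / (2x) * π y))`, for `n ≥ 1`. -/
noncomputable def sechTerm (k : ℕ) (x y : ℝ) (n : ℕ+) : ℝ :=
  Real.pi * (-1) ^ ((n : ℕ) - 1) /
    ((2 * (n : ℝ) - 1) ^ (2 * k + 1) * Real.cosh ((2 * (n : ℝ) - 1) / (2 * x) * Real.pi * y))

open Filter Topology

/-! ### Partial fraction expansion of the hyperbolic secant -/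

/-! With t = y/x, expand each sech as π/4 · sech(πs/2) = ∑ (-1)^n (2n+1)/((2n+1)² + s²). Both series
become double sums over odd a, b with the same denominator b² + a²t². Their combination is a finite
geometric sum in which this denominator cancels (`sum_alternating_quotient`), so it splits into
products of Dirichlet beta values, known through Euler numbers (`tendsto_betaPartialSum`).

The double sums are not absolutely convergent, so the identity is first proved for rectangular
partial sums. One side of the rectangle then tends to infinity with the other fixed, and then the
other, by dominated convergence from `abs_sechPartialSum_le`. -/

/-- Partial sums of the partial fraction expansion of `π / 4 * sech (π s / 2)`. -/
noncomputable def sechPartialSum (N : ℕ) (s : ℝ) : ℝ :=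
  ∑ n ∈ Finset.range N, (-1) ^ n * (2 * (n : ℝ) + 1) / ((2 * (n : ℝ) + 1) ^ 2 + s ^ 2)

/-- Partial sums of the Dirichlet beta series at the odd integer `2 j + 1`. -/
noncomputable def betaPartialSum (j N : ℕ) : ℝ :=
  ∑ n ∈ Finset.range N, (-1 : ℝ) ^ n / (2 * (n : ℝ) + 1) ^ (2 * j + 1)

/-- The two angles A, B add up to π/2, so sin(A+B) = 1 and 2 sin A sin B = cos(A-B) = cos z. -/
lemma cot_add_cot_eq_inv_cos (z : ℂ) (hz : Complex.cos z ≠ 0)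
    (h₁ : Complex.sin (Real.pi / 4 - z / 2) ≠ 0) (h₂ : Complex.sin (Real.pi / 4 + z / 2) ≠ 0) :
    Complex.cot (Real.pi / 4 - z / 2) + Complex.cot (Real.pi / 4 + z / 2) =
      2 / Complex.cos z := by
  have hsum : Complex.sin (Real.pi / 2) =
      Complex.sin ((Real.pi / 4 - z / 2) + (Real.pi / 4 + z / 2)) := by congr 1; ring
  have hdiff : Complex.cos z =
      Complex.cos ((Real.pi / 4 + z / 2) - (Real.pi / 4 - z / 2)) := by congr 1; ring
  have hzero : Complex.cos (Real.pi / 2) =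
      Complex.cos ((Real.pi / 4 - z / 2) + (Real.pi / 4 + z / 2)) := by congr 1; ring
  rw [Complex.sin_pi_div_two, Complex.sin_add] at hsum
  rw [Complex.cos_pi_div_two, Complex.cos_add] at hzero
  rw [Complex.cos_sub] at hdiff
  rw [Complex.cot, Complex.cot, div_add_div _ _ h₁ h₂, div_eq_div_iff (mul_ne_zero h₁ h₂) hz]
  linear_combination (Complex.cos z) * (-hsum) + hdiff - hzero

lemma quarter_add_mul_I_mem_integerComplement (s : ℝ) :
    (1 / 4 + s / 4 * Complex.I : ℂ) ∈ Complex.integerComplement := by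
  rintro ⟨n, hn⟩
  have h := congrArg Complex.re hn
  simp at h
  have h4 : (4 * n : ℤ) = 1 := by
    have : (4 * n : ℝ) = 1 := by rw [h]; norm_num
    exact_mod_cast this
  omega

/-- The poles at 1/4 ± is/4 pair up as 8b/(b² + s²), with b running through 1, -3, 5, -7, ...; the
signs of b give the alternation. Each cotangent term contributes two values of b besides b = 1,
hence the odd length. -/
lemma sum_cotTerm_add_eq (s : ℝ) (N : ℕ) :
    (1 / (1 / 4 + (-s : ℝ) / 4 * Complex.I) + ∑ j ∈ Finset.range N,
        cotTerm (1 / 4 + (-s : ℝ) / 4 * Complex.I) j) +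
      (1 / (1 / 4 + s / 4 * Complex.I) + ∑ j ∈ Finset.range N,
        cotTerm (1 / 4 + s / 4 * Complex.I) j) =
      ((8 * sechPartialSum (2 * N + 1) s : ℝ) : ℂ) := by
  have key (b : ℤ) (hb : b ≠ 0) : (1 / (b / 4 + (-s : ℝ) / 4 * Complex.I) +
      1 / (b / 4 + s / 4 * Complex.I) : ℂ) = 8 * (b / (b ^ 2 + s ^ 2)) := by
    have hne (u : ℝ) : (b / 4 + u / 4 * Complex.I : ℂ) ≠ 0 := by
      intro h
      have := congrArg Complex.re h
      simp at this
      exact hb this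
    have hq : (b ^ 2 + s ^ 2 : ℂ) ≠ 0 := by
      have : (0 : ℝ) < (b : ℝ) ^ 2 + s ^ 2 := by positivity
      exact_mod_cast this.ne'
    rw [div_add_div _ _ (hne _) (hne _), ← mul_div_assoc,
      div_eq_div_iff (mul_ne_zero (hne _) (hne _)) hq]
    push_cast
    linear_combination (-(1 / 2) * b * s ^ 2 : ℂ) * (-Complex.I_sq)
  induction N with
  | zero =>
    have := key 1 one_ne_zero
    simp only [Int.cast_one] at this
    simp [sechPartialSum] at this ⊢
    rw [this]
  | succ N ih =>
    have h₁ := key (4 * N + 5) (by omega)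
    have h₂ := key (-(4 * N + 3)) (by omega)
    have hS : sechPartialSum (2 * (N + 1) + 1) s = sechPartialSum (2 * N + 1) s
        - (4 * N + 3) / ((4 * N + 3) ^ 2 + s ^ 2) + (4 * N + 5) / ((4 * N + 5) ^ 2 + s ^ 2) := by
      rw [sechPartialSum, show 2 * (N + 1) + 1 = 2 * N + 1 + 1 + 1 by ring, Finset.sum_range_succ,
        Finset.sum_range_succ, ← sechPartialSum]
      have e₁ : (-1 : ℝ) ^ (2 * N + 1) = -1 := Odd.neg_one_pow ⟨N, rfl⟩
      rw [pow_succ _ (2 * N + 1), e₁]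
      push_cast
      ring_nf
    have f (u : ℝ) : cotTerm (1 / 4 + u / 4 * Complex.I) N =
        -(1 / ((-(4 * N + 3) : ℤ) / 4 + (-(-u) : ℝ) / 4 * Complex.I)) * (-1)
        + 1 / ((4 * N + 5 : ℤ) / 4 + u / 4 * Complex.I) := by
      rw [cotTerm]
      push_cast
      congr 1
      · rw [neg_mul_neg, mul_one]; congr 1; ring
      · congr 1; ring
    rw [Finset.sum_range_succ, Finset.sum_range_succ, hS, f, f]
    push_cast at h₁ h₂ ih ⊢
    simp only [neg_neg] at h₁ h₂ ih ⊢
    linear_combination ih + h₁ + h₂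

lemma tendsto_sechPartialSum (s : ℝ) :
    Tendsto (fun N => sechPartialSum (2 * N + 1) s) atTop
      (𝓝 (Real.pi / 4 / Real.cosh (Real.pi * s / 2))) := by
  have hw (u : ℝ) := quarter_add_mul_I_mem_integerComplement u
  have hlim (u : ℝ) : Tendsto (fun N : ℕ => (1 / (1 / 4 + u / 4 * Complex.I) +
      ∑ j ∈ Finset.range N, cotTerm (1 / 4 + u / 4 * Complex.I) j : ℂ)) atTop
      (𝓝 (Real.pi * Complex.cot (Real.pi * (1 / 4 + u / 4 * Complex.I)))) := by
    simpa using (tendsto_logDeriv_euler_cot_sub (hw u)).const_add (1 / (1 / 4 + u / 4 * Complex.I))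
  have h := (hlim (-s)).add (hlim s)
  simp_rw [sum_cotTerm_add_eq] at h
  set z : ℂ := ((Real.pi * s / 2 : ℝ) : ℂ) * Complex.I with hz
  have hcos : Complex.cos z = (Real.cosh (Real.pi * s / 2) : ℝ) := by
    rw [hz, Complex.cos_mul_I, Complex.ofReal_cosh]
  have hne : Complex.cos z ≠ 0 := by
    rw [hcos]; exact_mod_cast (Real.cosh_pos _).ne'
  have e₁ : (Real.pi * (1 / 4 + (-s : ℝ) / 4 * Complex.I) : ℂ) = Real.pi / 4 - z / 2 := by
    rw [hz]; push_cast; ring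
  have e₂ : (Real.pi * (1 / 4 + s / 4 * Complex.I) : ℂ) = Real.pi / 4 + z / 2 := by
    rw [hz]; push_cast; ring
  have n₁ := sin_pi_mul_ne_zero (hw (-s))
  have n₂ := sin_pi_mul_ne_zero (hw s)
  rw [e₁] at n₁ h
  rw [e₂] at n₂ h
  rw [← mul_add, cot_add_cot_eq_inv_cos z hne n₁ n₂, hcos] at h
  have h' : Tendsto (fun N => 8 * sechPartialSum (2 * N + 1) s) atTop
      (𝓝 (Real.pi * (2 / Real.cosh (Real.pi * s / 2)))) := by
    rw [← Complex.ofReal_ofNat 2, ← Complex.ofReal_div, ← Complex.ofReal_mul] at h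
    exact (Complex.continuous_re.tendsto _).comp h
  convert h'.const_mul (1 / 8) using 2
  · ring
  · ring

/-- Consecutive terms, taken in pairs, are dominated by a telescoping difference with total at most
2/|s|; the unpaired last term adds at most 1/|s|. The decay in s is what makes the domination
summable even for k = 0. -/
lemma abs_sechPartialSum_le (s : ℝ) (hs : s ≠ 0) (N : ℕ) :
    |sechPartialSum (2 * N + 1) s| ≤ 3 / |s| := by
  have hs' : 0 < |s| := abs_pos.mpr hs
  rw [show sechPartialSum (2 * N + 1) s = sechPartialSum (2 * N + 1) |s| by
    simp [sechPartialSum]]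
  generalize |s| = s at hs'
  have heven : |sechPartialSum (2 * N) s| ≤ 2 * (1 / s - 1 / (4 * N + s)) := by
    induction N with
    | zero => simp [sechPartialSum]
    | succ N ih =>
      have hS : sechPartialSum (2 * (N + 1)) s = sechPartialSum (2 * N) s
          + ((4 * N + 1) / ((4 * N + 1) ^ 2 + s ^ 2)
            - (4 * N + 3) / ((4 * N + 3) ^ 2 + s ^ 2)) := by
        rw [sechPartialSum, show 2 * (N + 1) = 2 * N + 1 + 1 by ring, Finset.sum_range_succ,
          Finset.sum_range_succ, ← sechPartialSum]
        rw [pow_succ _ (2 * N), pow_mul]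
        norm_num
        ring_nf
      have hN : (0 : ℝ) ≤ N := N.cast_nonneg
      have hpair : |((4 * N + 1) / ((4 * N + 1) ^ 2 + s ^ 2)
            - (4 * N + 3) / ((4 * N + 3) ^ 2 + s ^ 2) : ℝ)| ≤
          2 * (1 / (4 * N + s) - 1 / (4 * (N + 1) + s)) := by
        obtain ⟨b, hb, hb1⟩ : ∃ b : ℝ, 4 * (N : ℝ) + 1 = b ∧ 1 ≤ b := ⟨_, rfl, by linarith⟩
        have hd : b / (b ^ 2 + s ^ 2) - (b + 2) / ((b + 2) ^ 2 + s ^ 2) =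
            2 * (b * (b + 2) - s ^ 2) / ((b ^ 2 + s ^ 2) * ((b + 2) ^ 2 + s ^ 2)) := by
          field_simp
          ring
        have hr : 2 * (1 / (b - 1 + s) - 1 / (b + 3 + s)) =
            8 / ((b - 1 + s) * (b + 3 + s)) := by
          have : b - 1 + s ≠ 0 := by linarith
          field_simp
          ring
        rw [show (4 * N + 3 : ℝ) = b + 2 by linarith, hb, show (4 * N + s : ℝ) = b - 1 + s by linarith,
          show (4 * (N + 1) + s : ℝ) = b + 3 + s by linarith, hd, hr, abs_div,
          abs_of_pos (by positivity : 0 < (b ^ 2 + s ^ 2) * ((b + 2) ^ 2 + s ^ 2))]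
        have hnum : |2 * (b * (b + 2) - s ^ 2)| ≤ 2 * ((b + 2) ^ 2 + s ^ 2) := by
          rw [abs_le]; constructor <;> nlinarith
        calc _ ≤ 2 * ((b + 2) ^ 2 + s ^ 2) / ((b ^ 2 + s ^ 2) * ((b + 2) ^ 2 + s ^ 2)) := by gcongr
          _ = 2 / (b ^ 2 + s ^ 2) := by field_simp
          _ ≤ _ := by
            rw [div_le_div_iff₀ (by positivity)
              (mul_pos (by linarith) (by linarith))]
            nlinarith [sq_nonneg (b - s), sq_nonneg (b + s - 1)]
      rw [hS]
      calc _ ≤ _ := abs_add_le _ _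
        _ ≤ _ := add_le_add ih hpair
        _ = _ := by push_cast; ring
  have hlast : |(-1) ^ (2 * N) * (2 * ((2 * N : ℕ) : ℝ) + 1) /
      ((2 * ((2 * N : ℕ) : ℝ) + 1) ^ 2 + s ^ 2)| ≤ 1 / s := by
    rw [pow_mul, neg_one_sq, one_pow, one_mul]
    set b : ℝ := 2 * ((2 * N : ℕ) : ℝ) + 1
    have hb : 0 < b := by positivity
    rw [abs_of_pos (by positivity), div_le_div_iff₀ (by positivity) hs']
    nlinarith [sq_nonneg (b - s)]
  have hpos : 0 ≤ 1 / (4 * N + s) := by positivity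
  rw [sechPartialSum, Finset.sum_range_succ, ← sechPartialSum]
  calc _ ≤ _ := abs_add_le _ _
    _ ≤ 2 * (1 / s) + 1 / s := by linarith
    _ = 3 / s := by ring

/-! ### The Dirichlet beta function at odd integers and Euler numbers -/

/-- With h = e^{t/2} and q = e^{t/4}, the Bernoulli generating functions differ by t(q - qh)/(h² -
1) = -tq/(h + 1), which is -t/2 times the Euler generating function at t/2. -/
lemma bernoulli_quarter_sub_eq_eulerNumber (k : ℕ) :
    (Polynomial.aeval (1 / 4 : ℝ) (Polynomial.bernoulli (2 * k + 1)) -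
      Polynomial.aeval (3 / 4 : ℝ) (Polynomial.bernoulli (2 * k + 1))) / (2 * k + 1).factorial =
      -(1 / 2) * eulerNumber (2 * k) / (4 ^ (2 * k) * (2 * k).factorial) := by
  let G (t : ℝ) : PowerSeries ℝ := PowerSeries.mk fun n =>
    Polynomial.aeval t ((1 / n.factorial : ℚ) • Polynomial.bernoulli n)
  let H : PowerSeries ℝ := PowerSeries.C (2 : ℝ) *
    PowerSeries.rescale (1 / 2) (PowerSeries.exp ℝ) * (PowerSeries.exp ℝ + 1)⁻¹
  have hG (t : ℝ) : G t * (PowerSeries.exp ℝ - 1) =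
      PowerSeries.X * PowerSeries.rescale t (PowerSeries.exp ℝ) :=
    Polynomial.bernoulli_generating_function t
  have hH : H * (PowerSeries.exp ℝ + 1) =
      PowerSeries.C 2 * PowerSeries.rescale (1 / 2) (PowerSeries.exp ℝ) := by
    rw [mul_assoc, PowerSeries.inv_mul_cancel _ (by norm_num), mul_one]
  have hH' := congrArg (PowerSeries.rescale (1 / 2 : ℝ)) hH
  simp only [map_mul, map_add, map_one, PowerSeries.rescale_rescale] at hH'
  set h := PowerSeries.rescale (1 / 2 : ℝ) (PowerSeries.exp ℝ) with hh
  set q := PowerSeries.rescale (1 / 4 : ℝ) (PowerSeries.exp ℝ) with hq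
  have hexp : PowerSeries.exp ℝ = h * h := by
    have := PowerSeries.exp_mul_exp_eq_exp_add (A := ℝ) (1 / 2) (1 / 2)
    norm_num at this
    simpa [hh] using this.symm
  have h34 : PowerSeries.rescale (3 / 4 : ℝ) (PowerSeries.exp ℝ) = q * h := by
    have := PowerSeries.exp_mul_exp_eq_exp_add (A := ℝ) (1 / 4) (1 / 2)
    norm_num at this
    simpa [hh, hq] using this.symm
  have hqq : PowerSeries.rescale (1 / 2 * (1 / 2) : ℝ) (PowerSeries.exp ℝ) = q := by
    rw [hq]; norm_num
  have hC : PowerSeries.rescale (1 / 2 : ℝ) (PowerSeries.C (2 : ℝ)) = PowerSeries.C 2 := by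
    ext n; by_cases hn : n = 0 <;> simp [PowerSeries.coeff_rescale, PowerSeries.coeff_C, hn]
  rw [hqq, hC] at hH'
  have h1 : h - 1 ≠ 0 := by
    intro h0
    have := congrArg (PowerSeries.coeff 1) h0
    simp [hh, PowerSeries.coeff_rescale, PowerSeries.coeff_exp, PowerSeries.coeff_one] at this
  have h2 : h + 1 ≠ 0 := by
    intro h0
    have := congrArg (PowerSeries.coeff 0) h0
    rw [map_add, hh, PowerSeries.coeff_rescale] at this
    norm_num at this
  have key : PowerSeries.C 2 * (G (1 / 4) - G (3 / 4)) =
      -(PowerSeries.X * PowerSeries.rescale (1 / 2) H) := by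
    apply mul_right_cancel₀ (mul_ne_zero h1 h2)
    have g1 := hG (1 / 4)
    have g3 := hG (3 / 4)
    rw [h34] at g3
    rw [← hq] at g1
    rw [hexp] at g1 g3
    linear_combination PowerSeries.C 2 * g1 - PowerSeries.C 2 * g3 +
      PowerSeries.X * (h - 1) * hH'
  have hc := congrArg (PowerSeries.coeff (2 * k + 1)) key
  rw [PowerSeries.coeff_C_mul, map_neg, PowerSeries.coeff_succ_X_mul, PowerSeries.coeff_rescale,
    map_sub, PowerSeries.coeff_mk, PowerSeries.coeff_mk] at hc
  have hE : eulerNumber (2 * k) = 2 ^ (2 * k) * ((2 * k).factorial * PowerSeries.coeff (2 * k) H) :=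
    rfl
  simp only [map_smul, Rat.smul_def] at hc
  push_cast at hc
  rw [hE, show (4 : ℝ) ^ (2 * k) = 2 ^ (2 * k) * 2 ^ (2 * k) by rw [← mul_pow]; norm_num]
  have hf : ((2 * k).factorial : ℝ) ≠ 0 := by positivity
  rw [one_div_pow] at hc
  have h2k : (2 : ℝ) ^ (2 * k) ≠ 0 := by positivity
  calc _ = 1 / 2 * (2 * (1 / ((2 * k + 1).factorial : ℝ) *
        Polynomial.aeval (1 / 4 : ℝ) (Polynomial.bernoulli (2 * k + 1)) -
        1 / ((2 * k + 1).factorial : ℝ) *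
        Polynomial.aeval (3 / 4 : ℝ) (Polynomial.bernoulli (2 * k + 1)))) := by ring
    _ = _ := by rw [hc]; field_simp

lemma eulerNumber_zero : eulerNumber 0 = 1 := by
  have h : PowerSeries.constantCoeff (PowerSeries.rescale (2⁻¹ : ℝ) (PowerSeries.exp ℝ)) = 1 := by
    rw [← PowerSeries.coeff_zero_eq_constantCoeff_apply, PowerSeries.coeff_rescale]
    simp
  simp [eulerNumber, eulerPolynomial, h]
  norm_num

lemma tendsto_betaPartialSum (k : ℕ) :
    Tendsto (betaPartialSum k) atTop (𝓝 ((-1) ^ k * eulerNumber (2 * k) /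
      (2 * (2 * k).factorial) * (Real.pi / 2) ^ (2 * k + 1))) := by
  rcases eq_or_ne k 0 with rfl | hk
  -- The sine series of the Bernoulli polynomial needs k ≠ 0; k = 0 is Leibniz's series.
  · convert Real.tendsto_sum_pi_div_four using 2
    · simp [betaPartialSum]
    · simp [eulerNumber_zero]; ring
  have h₁ := hasSum_one_div_nat_pow_mul_sin hk (x := 1 / 4) ⟨by norm_num, by norm_num⟩
  have h₃ := hasSum_one_div_nat_pow_mul_sin hk (x := 3 / 4) ⟨by norm_num, by norm_num⟩
  have h := ((h₁.sub h₃).mul_left (1 / 2)).tendsto_sum_nat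
  have h2 := h.comp (tendsto_id.const_mul_atTop' (by norm_num : 0 < 2))
  have hb := bernoulli_quarter_sub_eq_eulerNumber k
  rw [Polynomial.aeval_def, Polynomial.aeval_def, ← Polynomial.eval_map, ← Polynomial.eval_map]
    at hb
  convert h2 using 1
  · funext N
    simp only [Function.comp, id]
    induction N with
    | zero => simp [betaPartialSum]
    | succ N ih =>
      rw [betaPartialSum, Finset.sum_range_succ, ← betaPartialSum, ih,
        show 2 * (N + 1) = 2 * N + 1 + 1 by ring, Finset.sum_range_succ, Finset.sum_range_succ,
        add_assoc]
      congr 1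
      -- The difference of the sines at 1/4 and 3/4 vanishes for even index and is 2(-1)^N at 2N +
      -- 1.
      have s₁ : Real.sin (2 * Real.pi * (2 * N : ℕ) * (1 / 4)) = 0 := by
        rw [show 2 * Real.pi * (2 * N : ℕ) * (1 / 4) = N * Real.pi by push_cast; ring,
          Real.sin_nat_mul_pi]
      have s₂ : Real.sin (2 * Real.pi * (2 * N : ℕ) * (3 / 4)) = 0 := by
        rw [show 2 * Real.pi * (2 * N : ℕ) * (3 / 4) = (3 * N : ℕ) * Real.pi by push_cast; ring,
          Real.sin_nat_mul_pi]
      have s₃ : Real.sin (2 * Real.pi * (2 * N + 1 : ℕ) * (1 / 4)) = (-1) ^ N := by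
        rw [show 2 * Real.pi * (2 * N + 1 : ℕ) * (1 / 4) = Real.pi / 2 + N * Real.pi by
          push_cast; ring, Real.sin_add_nat_mul_pi, Real.sin_pi_div_two, mul_one]
      have s₄ : Real.sin (2 * Real.pi * (2 * N + 1 : ℕ) * (3 / 4)) = -(-1) ^ N := by
        rw [show 2 * Real.pi * (2 * N + 1 : ℕ) * (3 / 4) =
          Real.pi / 2 + (3 * N + 1 : ℕ) * Real.pi by
          push_cast; ring, Real.sin_add_nat_mul_pi, Real.sin_pi_div_two, mul_one, pow_succ, pow_mul]
        norm_num
      rw [s₁, s₂, s₃, s₄]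
      push_cast
      ring
  · congr 1
    have hf : ((2 * k + 1).factorial : ℝ) ≠ 0 := by positivity
    rw [← mul_sub]
    rw [div_eq_iff hf] at hb
    rw [hb]
    have e : (2 * Real.pi) ^ (2 * k + 1) = 4 ^ (2 * k) * 4 * (Real.pi / 2) ^ (2 * k + 1) := by
      rw [← pow_succ, ← mul_pow]; congr 1; ring
    rw [e]
    field_simp
    ring

/-- An alternating series with decreasing terms and positive first term has a nonnegative sum. -/
lemma neg_one_pow_mul_eulerNumber_nonneg (k : ℕ) : 0 ≤ (-1) ^ k * eulerNumber (2 * k) := by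
  have h := (tendsto_betaPartialSum k).comp (tendsto_id.const_mul_atTop' (by norm_num : 0 < 2))
  have hnn : 0 ≤ (-1) ^ k * eulerNumber (2 * k) /
      (2 * (2 * k).factorial) * (Real.pi / 2) ^ (2 * k + 1) := by
    refine ge_of_tendsto' h fun N => ?_
    simp only [Function.comp, id]
    induction N with
    | zero => simp [betaPartialSum]
    | succ N ih =>
      rw [betaPartialSum, show 2 * (N + 1) = 2 * N + 1 + 1 by ring, Finset.sum_range_succ,
        Finset.sum_range_succ, ← betaPartialSum, pow_succ _ (2 * N), pow_mul, neg_one_sq, one_pow,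
        add_assoc]
      refine add_nonneg ih ?_
      have : 1 / (2 * ((2 * N + 1 : ℕ) : ℝ) + 1) ^ (2 * k + 1) ≤
          1 / (2 * ((2 * N : ℕ) : ℝ) + 1) ^ (2 * k + 1) := by
        gcongr
        omega
      rw [one_mul, neg_div]
      linarith
  by_contra! hneg
  have : (-1) ^ k * eulerNumber (2 * k) /
      (2 * (2 * k).factorial) * (Real.pi / 2) ^ (2 * k + 1) < 0 :=
    mul_neg_of_neg_of_pos (div_neg_of_neg_of_pos hneg (by positivity)) (by positivity)
  linarith

lemma abs_eulerNumber_two_mul (k : ℕ) : |eulerNumber (2 * k)| = (-1) ^ k * eulerNumber (2 * k) := by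
  rw [← abs_of_nonneg (neg_one_pow_mul_eulerNumber_nonneg k), abs_mul, abs_pow, abs_neg, abs_one,
    one_pow, one_mul]

/-! ### The reciprocity formula -/

lemma summable_inv_two_mul_add_one_sq : Summable fun n : ℕ => 1 / (2 * (n : ℝ) + 1) ^ 2 := by
  have h := (Real.summable_one_div_nat_pow (p := 2)).mpr one_lt_two
  refine ((summable_nat_add_iff 1).mpr h).of_nonneg_of_le (fun n => by positivity) fun n => ?_
  push_cast
  gcongr
  linarith [n.cast_nonneg (α := ℝ)]

lemma abs_le_cosh (x : ℝ) : |x| ≤ Real.cosh x := by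
  rw [← Real.cosh_abs, Real.cosh_eq]
  have h₁ := Real.quadratic_le_exp_of_nonneg (abs_nonneg x)
  have h₂ := Real.add_one_le_exp (-|x|)
  nlinarith [sq_nonneg (|x| - 2)]

lemma summable_sech (k : ℕ) (t : ℝ) (ht : t ≠ 0) :
    Summable fun n : ℕ => (-1 : ℝ) ^ n / (2 * (n : ℝ) + 1) ^ (2 * k + 1) *
      (Real.pi / 4 / Real.cosh (Real.pi * ((2 * (n : ℝ) + 1) * t) / 2)) := by
  refine Summable.of_norm_bounded
    (g := fun n : ℕ => 1 / (2 * |t|) * (1 / (2 * (n : ℝ) + 1) ^ 2))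
    (summable_inv_two_mul_add_one_sq.mul_left _) fun n => ?_
  set b : ℝ := 2 * (n : ℝ) + 1 with hb
  have hb1 : 1 ≤ b := by rw [hb]; linarith [n.cast_nonneg (α := ℝ)]
  have ht' : 0 < |t| := abs_pos.mpr ht
  have hpi := Real.pi_pos
  have hcosh := abs_le_cosh (Real.pi * (b * t) / 2)
  rw [abs_div, abs_mul, abs_mul, abs_of_pos hpi, abs_of_pos (by linarith : 0 < b), abs_two] at hcosh
  rw [Real.norm_eq_abs, abs_mul, abs_div, abs_pow, abs_neg, abs_one, one_pow,
    abs_of_pos (by positivity : 0 < b ^ (2 * k + 1)),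
    abs_of_pos (div_pos (by positivity) (Real.cosh_pos _))]
  calc _ ≤ 1 / b * (Real.pi / 4 / (Real.pi * (b * |t|) / 2)) := by
        gcongr
        exact le_self_pow₀ hb1 (by omega)
    _ = _ := by field_simp; norm_num

/-- A geometric sum of ratio -(at/b)², up to a common factor; induction on k adds one term at a
time. -/
lemma sum_alternating_quotient (a b t : ℝ) (ha : 0 < a) (hb : 0 < b) (ht : t ≠ 0) (k : ℕ) :
    1 / a ^ (2 * k + 1) * (b / (b ^ 2 + (a * t) ^ 2)) +
      (-1) ^ k * t ^ (2 * k) * (1 / b ^ (2 * k + 1) * (a / (a ^ 2 + (b * t⁻¹) ^ 2))) =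
      ∑ i ∈ Finset.range (k + 1),
        (-1) ^ i * t ^ (2 * i) * (1 / a ^ (2 * (k - i) + 1) * (1 / b ^ (2 * i + 1))) := by
  have e : a / (a ^ 2 + (b * t⁻¹) ^ 2) = t ^ 2 * (a / (b ^ 2 + (a * t) ^ 2)) := by
    field_simp
    ring
  rw [e]
  have hv : b ^ 2 + (a * t) ^ 2 ≠ 0 := by positivity
  induction k with
  | zero => simp; field_simp
  | succ k ih =>
    rw [Finset.sum_range_succ]
    have hs : ∑ i ∈ Finset.range (k + 1),
        (-1) ^ i * t ^ (2 * i) * (1 / a ^ (2 * (k + 1 - i) + 1) * (1 / b ^ (2 * i + 1))) =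
        1 / a ^ 2 * ∑ i ∈ Finset.range (k + 1),
        (-1) ^ i * t ^ (2 * i) * (1 / a ^ (2 * (k - i) + 1) * (1 / b ^ (2 * i + 1))) := by
      rw [Finset.mul_sum]
      refine Finset.sum_congr rfl fun i hi => ?_
      have : i ≤ k := by simpa [Nat.lt_succ_iff] using hi
      rw [show 2 * (k + 1 - i) + 1 = 2 * (k - i) + 1 + 2 by omega, pow_add a]
      field_simp
    rw [hs, ← ih, Nat.sub_self, mul_zero, zero_add, pow_one,
      show 2 * (k + 1) + 1 = 2 * k + 1 + 2 by ring, show 2 * (k + 1) = 2 * k + 2 by ring,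
      pow_add a, pow_add b, pow_add t, pow_succ (-1 : ℝ)]
    field_simp
    ring

lemma sum_mul_sechPartialSum (k M N : ℕ) (t : ℝ) (ht : t ≠ 0) :
    ∑ m ∈ Finset.range N, (-1 : ℝ) ^ m / (2 * (m : ℝ) + 1) ^ (2 * k + 1) *
        sechPartialSum M ((2 * (m : ℝ) + 1) * t) +
      (-1) ^ k * t ^ (2 * k) *
        ∑ n ∈ Finset.range M, (-1 : ℝ) ^ n / (2 * (n : ℝ) + 1) ^ (2 * k + 1) *
          sechPartialSum N ((2 * (n : ℝ) + 1) * t⁻¹) =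
      ∑ i ∈ Finset.range (k + 1),
        (-1) ^ i * t ^ (2 * i) * (betaPartialSum (k - i) N * betaPartialSum i M) := by
  simp only [betaPartialSum, sechPartialSum, Finset.sum_mul_sum]
  simp only [Finset.mul_sum]
  rw [Finset.sum_comm (s := Finset.range M) (t := Finset.range N), Finset.sum_comm
    (s := Finset.range (k + 1)), ← Finset.sum_add_distrib]
  refine Finset.sum_congr rfl fun m _ => ?_
  rw [Finset.sum_comm (s := Finset.range (k + 1)), ← Finset.sum_add_distrib]
  refine Finset.sum_congr rfl fun n _ => ?_
  have h := sum_alternating_quotient (2 * m + 1) (2 * n + 1) t (by positivity) (by positivity) ht k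
  refine Eq.trans ?_ ((congrArg (fun z => (-1) ^ m * (-1) ^ n * z) h).trans ?_)
  · ring
  · rw [Finset.mul_sum]
    exact Finset.sum_congr rfl fun i _ => by ring

lemma tsum_sech_reciprocity (k : ℕ) (t : ℝ) (ht : t ≠ 0) :
    ∑' n : ℕ, (-1 : ℝ) ^ n / (2 * (n : ℝ) + 1) ^ (2 * k + 1) *
        (Real.pi / 4 / Real.cosh (Real.pi * ((2 * (n : ℝ) + 1) * t) / 2)) +
      (-1) ^ k * t ^ (2 * k) *
        ∑' n : ℕ, (-1 : ℝ) ^ n / (2 * (n : ℝ) + 1) ^ (2 * k + 1) *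
          (Real.pi / 4 / Real.cosh (Real.pi * ((2 * (n : ℝ) + 1) * t⁻¹) / 2)) =
      ∑ i ∈ Finset.range (k + 1), (-1) ^ i * t ^ (2 * i) *
        (((-1) ^ (k - i) * eulerNumber (2 * (k - i)) / (2 * (2 * (k - i)).factorial) *
            (Real.pi / 2) ^ (2 * (k - i) + 1)) *
          ((-1) ^ i * eulerNumber (2 * i) / (2 * (2 * i).factorial) *
            (Real.pi / 2) ^ (2 * i + 1))) := by
  have hodd : Tendsto (fun N : ℕ => 2 * N + 1) atTop atTop :=
    tendsto_atTop_mono (fun N => by simp only [id]; omega) tendsto_id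
  have hbound (m M : ℕ) : ‖(-1 : ℝ) ^ m / (2 * (m : ℝ) + 1) ^ (2 * k + 1) *
      sechPartialSum (2 * M + 1) ((2 * (m : ℝ) + 1) * t)‖ ≤
      3 / |t| * (1 / (2 * (m : ℝ) + 1) ^ 2) := by
    set b : ℝ := 2 * (m : ℝ) + 1 with hb
    have hb1 : 1 ≤ b := by rw [hb]; linarith [m.cast_nonneg (α := ℝ)]
    have hb0 : 0 < b := by linarith
    have ht' : 0 < |t| := abs_pos.mpr ht
    have hS := abs_sechPartialSum_le (b * t) (mul_ne_zero hb0.ne' ht) M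
    rw [abs_mul, abs_of_pos hb0] at hS
    rw [Real.norm_eq_abs, abs_mul, abs_div, abs_pow, abs_neg, abs_one, one_pow,
      abs_of_pos (by positivity : 0 < b ^ (2 * k + 1))]
    calc _ ≤ 1 / b * (3 / (b * |t|)) := by
          gcongr
          exact le_self_pow₀ hb1 (by omega)
      _ = _ := by field_simp
  have hsum := summable_inv_two_mul_add_one_sq.mul_left (3 / |t|)
  -- Limit N → ∞ with M fixed: the second sum is finite, so termwise limits suffice there.
  have hfix (M : ℕ) : ∑' m : ℕ, (-1 : ℝ) ^ m / (2 * (m : ℝ) + 1) ^ (2 * k + 1) *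
        sechPartialSum (2 * M + 1) ((2 * (m : ℝ) + 1) * t) +
      (-1) ^ k * t ^ (2 * k) *
        ∑ n ∈ Finset.range (2 * M + 1), (-1 : ℝ) ^ n / (2 * (n : ℝ) + 1) ^ (2 * k + 1) *
          (Real.pi / 4 / Real.cosh (Real.pi * ((2 * (n : ℝ) + 1) * t⁻¹) / 2)) =
      ∑ i ∈ Finset.range (k + 1), (-1) ^ i * t ^ (2 * i) *
        (((-1) ^ (k - i) * eulerNumber (2 * (k - i)) / (2 * (2 * (k - i)).factorial) *
            (Real.pi / 2) ^ (2 * (k - i) + 1)) * betaPartialSum i (2 * M + 1)) := by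
    have hL := (((Summable.of_norm_bounded hsum fun m => hbound m M).hasSum.tendsto_sum_nat).comp
      hodd).add ((tendsto_finsetSum (Finset.range (2 * M + 1)) fun n _ =>
        (tendsto_sechPartialSum ((2 * (n : ℝ) + 1) * t⁻¹)).const_mul
          ((-1 : ℝ) ^ n / (2 * (n : ℝ) + 1) ^ (2 * k + 1))).const_mul ((-1) ^ k * t ^ (2 * k)))
    have hR := tendsto_finsetSum (Finset.range (k + 1)) fun i _ =>
      (((tendsto_betaPartialSum (k - i)).comp hodd).mul_const
        (betaPartialSum i (2 * M + 1))).const_mul ((-1) ^ i * t ^ (2 * i))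
    refine tendsto_nhds_unique hL (hR.congr fun N => ?_)
    exact (sum_mul_sechPartialSum k (2 * M + 1) (2 * N + 1) t ht).symm
  have hL := (tendsto_tsum_of_dominated_convergence hsum
    (fun m => (tendsto_sechPartialSum ((2 * (m : ℝ) + 1) * t)).const_mul
      ((-1 : ℝ) ^ m / (2 * (m : ℝ) + 1) ^ (2 * k + 1)))
    (Eventually.of_forall fun M m => hbound m M)).add
    ((((summable_sech k t⁻¹ (inv_ne_zero ht)).hasSum.tendsto_sum_nat).comp hodd).const_mul
      ((-1) ^ k * t ^ (2 * k)))
  have hR := tendsto_finsetSum (Finset.range (k + 1)) fun i _ =>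
    (((tendsto_betaPartialSum i).comp hodd).const_mul
      ((-1) ^ (k - i) * eulerNumber (2 * (k - i)) / (2 * (2 * (k - i)).factorial) *
        (Real.pi / 2) ^ (2 * (k - i) + 1))).const_mul ((-1) ^ i * t ^ (2 * i))
  exact tendsto_nhds_unique hL (hR.congr fun M => (hfix M).symm)

lemma sechTerm_succPNat (k : ℕ) (x y : ℝ) (n : ℕ) :
    sechTerm k x y n.succPNat = 4 * ((-1 : ℝ) ^ n / (2 * (n : ℝ) + 1) ^ (2 * k + 1) *
      (Real.pi / 4 / Real.cosh (Real.pi * ((2 * (n : ℝ) + 1) * (y / x)) / 2))) := by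
  have h₁ : (2 * ((n.succPNat : ℕ) : ℝ) - 1) = 2 * n + 1 := by
    rw [Nat.succPNat_coe]; push_cast; ring
  have h₂ : (2 * n + 1) / (2 * x) * Real.pi * y =
      Real.pi * ((2 * (n : ℝ) + 1) * (y / x)) / 2 := by
    rw [mul_comm 2 x, ← div_div]; ring
  rw [sechTerm, h₁, h₂, Nat.succPNat_coe, Nat.succ_sub_one]
  have := (Real.cosh_pos (Real.pi * ((2 * (n : ℝ) + 1) * (y / x)) / 2)).ne'
  field_simp

lemma summable_sechTerm (k : ℕ) (x y : ℝ) (hx : x ≠ 0) (hy : y ≠ 0) :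
    Summable (sechTerm k x y) := by
  rw [← Equiv.pnatEquivNat.symm.summable_iff]
  exact ((summable_sech k (y / x) (div_ne_zero hy hx)).mul_left 4).congr
    fun n => (sechTerm_succPNat k x y n).symm

lemma tsum_sechTerm (k : ℕ) (x y : ℝ) :
    ∑' n, sechTerm k x y n = 4 * ∑' n : ℕ, (-1 : ℝ) ^ n / (2 * (n : ℝ) + 1) ^ (2 * k + 1) *
      (Real.pi / 4 / Real.cosh (Real.pi * ((2 * (n : ℝ) + 1) * (y / x)) / 2)) := by
  rw [← Equiv.pnatEquivNat.symm.tsum_eq, ← tsum_mul_left]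
  exact tsum_congr fun n => sechTerm_succPNat k x y n

theorem theorem2p5 (k : ℕ) (x y : ℝ) (hx : x ≠ 0) (hy : y ≠ 0) :
    Summable (sechTerm k x y) ∧ Summable (sechTerm k y x) ∧
    (∑' n : ℕ+, sechTerm k x y n) * x ^ (2 * k) +
        (-1) ^ k * (∑' n : ℕ+, sechTerm k y x n) * y ^ (2 * k) =
      ∑ p ∈ Finset.HasAntidiagonal.antidiagonal k,
        |eulerNumber (2 * p.1)| * eulerNumber (2 * p.2) /
            (((2 * p.1).factorial : ℝ) * ((2 * p.2).factorial : ℝ)) *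
          x ^ (2 * p.1) * y ^ (2 * p.2) * (Real.pi / 2) ^ (2 * k + 2) := by
  refine ⟨summable_sechTerm k x y hx hy, summable_sechTerm k y x hy hx, ?_⟩
  have h := tsum_sech_reciprocity k (y / x) (div_ne_zero hy hx)
  rw [inv_div] at h
  rw [tsum_sechTerm, tsum_sechTerm]
  set A := ∑' n : ℕ, (-1 : ℝ) ^ n / (2 * (n : ℝ) + 1) ^ (2 * k + 1) *
      (Real.pi / 4 / Real.cosh (Real.pi * ((2 * (n : ℝ) + 1) * (y / x)) / 2))
  set B := ∑' n : ℕ, (-1 : ℝ) ^ n / (2 * (n : ℝ) + 1) ^ (2 * k + 1) *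
      (Real.pi / 4 / Real.cosh (Real.pi * ((2 * (n : ℝ) + 1) * (x / y)) / 2))
  have hAB : 4 * A * x ^ (2 * k) + (-1) ^ k * (4 * B) * y ^ (2 * k) =
      4 * x ^ (2 * k) * (A + (-1) ^ k * (y / x) ^ (2 * k) * B) := by
    rw [div_pow]
    field_simp
  -- The swap makes i the exponent of y; the sign (-1)^j is absorbed into |E_{2j}| and the two signs
  -- (-1)^i cancel.
  rw [hAB, h, Finset.mul_sum, ← Finset.Nat.sum_antidiagonal_swap,
    Finset.Nat.sum_antidiagonal_eq_sum_range_succ_mk]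
  refine Finset.sum_congr rfl fun i hi => ?_
  obtain ⟨j, rfl⟩ : ∃ j, k = i + j := ⟨k - i, by have := Finset.mem_range.mp hi; omega⟩
  simp only [Prod.fst_swap, Prod.snd_swap, Nat.add_sub_cancel_left]
  have hi2 : (-1 : ℝ) ^ i * (-1) ^ i = 1 := by rw [← mul_pow]; norm_num
  have hx2 : x ^ (2 * (i + j)) * (y / x) ^ (2 * i) = x ^ (2 * j) * y ^ (2 * i) := by
    rw [div_pow, mul_add, pow_add]
    field_simp
  have hpi : (Real.pi / 2) ^ (2 * (i + j) + 2) =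
      (Real.pi / 2) ^ (2 * j + 1) * (Real.pi / 2) ^ (2 * i + 1) := by
    rw [← pow_add]; congr 1; ring
  rw [abs_eulerNumber_two_mul, hpi]
  calc _ = ((-1) ^ i * (-1) ^ i) * (x ^ (2 * (i + j)) * (y / x) ^ (2 * i)) *
        ((-1) ^ j * eulerNumber (2 * j) / (2 * j).factorial *
          (Real.pi / 2) ^ (2 * j + 1) * (eulerNumber (2 * i) / (2 * i).factorial *
          (Real.pi / 2) ^ (2 * i + 1))) := by
        field_simp
        ring
    _ = _ := by
        rw [hi2, hx2]
        field_simp
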